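/- Let $Z$ be a positive random variable with law $\mu$ such that: (1) $\mathbb E[Z]>1$ and $\mathbb E[\log Z]<0$; (2) there are $0<c_-<c_+<\infty$ with $\mathbb P(Z\in[c_-,c_+])=1$, and no smaller closed interval has this property; (3) $\mu$ is absolutely continuous with respect to Lebesgue measure on $\mathbb R$, with a density that is continuously differentiable on $\mathbb R$. Let $\alpha>0$ be the positive real solution of $\mathbb E[Z^\alpha]=1$, and let $\delta>0$ be such that $\delta\le\alpha$, $\delta\le 1-\alpha$, and $\mathbb E[Z^z]=\int t^z\,\mu(\mathrm dt)\neq 1$ for every complex $z\neq\alpha$ with $\operatorname{Re} z\in[\alpha,\alpha+\delta]$. Let $\nu_0$ be the stationary probability measure on $(0,\infty)$ of the Markov chain $s\mapsto Z(1+s)$; that is, if $s$ has law $\nu_0$ and $Z$ is independent of $s$ with law $\mu$, then $Z(1+s)$ has law $\nu_0$. Write $G_{\nu_0}(t)=\nu_0((t,\infty))$. Then there are a constant $C_\nu\neq 0$ and a function $R_\nu:(0,\infty)\to\mathbb R$ such that $$G_{\nu_0}(t)=C_\nu\left[t^{-\alpha}+R_\nu(t)\right]\quad\text{for all } t>0,\qquad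 R_\nu(t)=O(t^{-\alpha-\delta})\quad\text{as } t\to\infty .$$ -/

import Mathlib

open MeasureTheory Set Filter Asymptotics

namespace DerridaHilhorst

/-- Standing assumptions on the law `μ` of the positive random variable `Z`. -/
structure IsAdmissibleLaw (μ : Measure ℝ) (cm cp : ℝ) : Prop where
  /-- `μ` is a probability measure. -/
  prob : IsProbabilityMeasure μ
  /-- `E[Z] > 1`. -/
  one_lt_mean : 1 < ∫ z, z ∂μ
  /-- `E[log Z] < 0`. -/
  log_mean_neg : ∫ z, Real.log z ∂μ < 0
  cm_pos : 0 < cm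
  cm_lt_cp : cm < cp
  /-- `Z` lies in `[cm, cp]` almost surely. -/
  mem_Icc : μ (Icc cm cp) = 1
  /-- No smaller closed interval carries `Z` almost surely. -/
  minimal : ∀ a b : ℝ, μ (Icc a b) = 1 → Icc cm cp ⊆ Icc a b
  /-- `μ` has a continuously differentiable density on the real line. -/
  density : ∃ f : ℝ → ℝ, ContDiff ℝ 1 f ∧ (∀ x, 0 ≤ f x) ∧
    μ = (volume : Measure ℝ).withDensity (fun x => ENNReal.ofReal (f x))

/-- `g_ε(s) = (1 + s) / (1 + ε² s)`. -/
noncomputable def g (ε s : ℝ) : ℝ := (1 + s) / (1 + ε ^ 2 * s)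

/-- The transition operator `T_ε` on measures: `T_ε ν` is the law of `Z g_ε(s)` where
`s` has law `ν` and `Z` is independent of `s` with law `μ`. For `ε = 0` this is one step of the
chain `s ↦ Z (1 + s)`. -/
noncomputable def T (μ : Measure ℝ) (ε : ℝ) (ν : Measure ℝ) : Measure ℝ :=
  (ν.prod μ).map (fun p : ℝ × ℝ => p.2 * g ε p.1)

/-- `ν₀` is a stationary probability measure, carried by `(0, ∞)`, of the chain `s ↦ Z (1 + s)`. -/
structure IsStationary (μ ν₀ : Measure ℝ) : Prop where
  prob : IsProbabilityMeasure ν₀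
  support : ν₀ (Iic 0) = 0
  fixed : T μ 0 ν₀ = ν₀

/-- The tail distribution function `G_ν(t) = ν((t, ∞))`. -/
noncomputable def G (ν : Measure ℝ) (t : ℝ) : ℝ := ν.real (Ioi t)

/-- The complex moment function `M(u) = ∫ t ^ u μ(dt) = E[Z ^ u]`. -/
noncomputable def M (μ : Measure ℝ) (u : ℂ) : ℂ := ∫ t : ℝ, (t : ℂ) ^ u ∂μ

end DerridaHilhorst

/-! The proof is Mellin inversion followed by a shift of contour. Write `M(u) = E[Z ^ u]` and
`φ(u) = ∫ ((1 + s) ^ u - s ^ u) ν₀(ds)`. The law of `s` is that of `Z (1 + s)`, so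
`E[s ^ u] (1 - M(u)) = M(u) φ(u)`, and the Mellin transform of the tail function `G_{ν₀}` is
`F(u) = M(u) φ(u) / (u (1 - M(u)))` for `0 < Re u < α`, where the moments of `ν₀` are finite
because `E[Z ^ (Re u)] < 1` there (`IsStationary.lintegral_rpow_lt_top`,
`IsStationary.hasMellin_G_tailTransform`).

The function `φ` is finite up to `Re u = 1`, hence `F` continues meromorphically up to the line
`Re u = α + δ`, and its only singularity there is a pole at `α`. That pole is simple with residue
`-C`, where `C = φ(α) / (α M'(α)) > 0` (`IsStationary.exists_tendsto_sub_mul_tailTransform`); the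
transform of `C * min (1, t ^ (-α))` has the same pole and is subtracted.

The line of integration can be moved because `F` decays quadratically
(`IsStationary.exists_norm_tailTransform_le`): integration by parts against the `C¹` density of
`Z` gives `M(u) = O(1 / |u|)`, and a second use of it, after replacing `s` by `Z (1 + s)` in `φ`,
shows that `φ` is bounded. On the line `Re u = α + δ` the inversion integral is
`O(t ^ (-α - δ))` (`exists_norm_le_rpow_of_mellin`). -/

namespace DerridaHilhorst

open Complex Topology

/-! ### Holomorphy of parametric integrals and shifting of contours -/

/-- Differentiation under the integral sign for holomorphic integrands: a bound on the integrand
alone suffices, since Cauchy's estimate turns it into a bound on the derivative. -/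
theorem hasDerivAt_integral_of_norm_le {X : Type*} [MeasurableSpace X] {ν : Measure X}
    [IsFiniteMeasure ν] {U : Set ℂ} (hU : IsOpen U) {F F' : ℂ → X → ℂ} {B : ℂ → ℝ}
    (hB : ContinuousOn B U) (hF : ∀ u ∈ U, AEStronglyMeasurable (F u) ν)
    (hF' : ∀ u ∈ U, AEStronglyMeasurable (F' u) ν)
    (hderiv : ∀ᵐ x ∂ν, ∀ u ∈ U, HasDerivAt (fun v => F v x) (F' u x) u)
    (hbound : ∀ᵐ x ∂ν, ∀ u ∈ U, ‖F u x‖ ≤ B u) {u : ℂ} (hu : u ∈ U) :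
    HasDerivAt (fun v => ∫ x, F v x ∂ν) (∫ x, F' u x ∂ν) u := by
  have hnear : ∀ᶠ v in 𝓝 u, v ∈ U ∧ B v < B u + 1 := by
    have hmem : U ∈ 𝓝 u := hU.mem_nhds hu
    exact Filter.Eventually.and hmem
      ((hB.continuousAt hmem).eventually_lt continuousAt_const (by simp))
  obtain ⟨r, hr, hball⟩ := Metric.eventually_nhds_iff_ball.mp hnear
  have hr2 : 0 < r / 2 := by positivity
  have hr4 : 0 < r / 4 := by positivity
  refine (hasDerivAt_integral_of_dominated_loc_of_deriv_le (bound := fun _ => (B u + 1) / (r / 2))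
    (Metric.ball_mem_nhds u hr2) ?_ ?_ (hF' u hu) ?_ (integrable_const _) ?_).2
  · exact (hU.eventually_mem hu).mono hF
  · refine Integrable.of_bound (hF u hu) (B u) ?_
    filter_upwards [hbound] with x hx using hx u hu
  · filter_upwards [hderiv, hbound] with x hx hxb v hv
    have hsub : Metric.closedBall v (r / 2) ⊆ Metric.ball u r := by
      intro w hw
      rw [Metric.mem_closedBall] at hw
      rw [Metric.mem_ball] at hv ⊢
      linarith [dist_triangle w v u]
    have hv' := hball v (hsub (Metric.mem_closedBall_self hr2.le))
    rw [← (hx v hv'.1).deriv]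
    refine norm_deriv_le_of_forall_mem_sphere_norm_le hr2 ?_ ?_
    · apply DifferentiableOn.diffContOnCl
      rw [closure_ball _ hr2.ne']
      intro w hw
      exact (hx w (hball w (hsub hw)).1).differentiableAt.differentiableWithinAt
    · intro w hw
      have := hball w (hsub (Metric.sphere_subset_closedBall hw))
      exact (hxb w this.1).trans this.2.le
  · filter_upwards [hderiv] with x hx v hv
    exact hx v (hball v (Metric.ball_subset_ball (by linarith) hv)).1

theorem integrable_of_norm_le_div_sq {h : ℝ → ℂ} (hc : Continuous h) {K T : ℝ}
    (hK : ∀ y, T ≤ |y| → ‖h y‖ ≤ K / y ^ 2) : Integrable h := by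
  have key : ∀ y : ℝ, max T 1 ≤ |y| → ‖h y‖ ≤ (2 * |K|) * ‖(1 + y ^ 2)⁻¹‖ := by
    intro y hy
    have h1 : (1 : ℝ) ≤ y ^ 2 := by
      rw [← sq_abs]
      nlinarith [le_of_max_le_right hy]
    refine (hK y (le_of_max_le_left hy)).trans ?_
    rw [Real.norm_of_nonneg (by positivity), ← div_eq_mul_inv, div_le_div_iff₀ (by positivity)
      (by positivity)]
    nlinarith [le_abs_self K, abs_nonneg K]
  refine hc.locallyIntegrable.integrable_of_isBigO_atBot_atTop
    (g := fun y : ℝ => (1 + y ^ 2)⁻¹) (g' := fun y : ℝ => (1 + y ^ 2)⁻¹) ?_ ?_ ?_ ?_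
  · refine IsBigO.of_bound (2 * |K|) ?_
    filter_upwards [eventually_le_atBot (-(max T 1))] with y hy
    exact key y ((by linarith : max T 1 ≤ -y).trans (neg_le_abs y))
  · exact integrable_inv_one_add_sq.integrableAtFilter _
  · refine IsBigO.of_bound (2 * |K|) ?_
    filter_upwards [eventually_ge_atTop (max T 1)] with y hy
    exact key y (hy.trans (le_abs_self y))
  · exact integrable_inv_one_add_sq.integrableAtFilter _

theorem continuous_comp_vertical {E : ℂ → ℂ} {S : Set ℝ} (hE : ContinuousOn E {u | u.re ∈ S})
    {x : ℝ} (hx : x ∈ S) : Continuous fun y : ℝ => E (x + y * I) :=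
  hE.comp_continuous (by fun_prop) (fun y => by simpa using hx)

/-- Shifting a vertical line of integration across a strip. -/
theorem integral_vertical_eq {E : ℂ → ℂ} {a b : ℝ} (hab : a ≤ b)
    (hc : ContinuousOn E {u | u.re ∈ Icc a b})
    (hd : ∀ u : ℂ, u.re ∈ Ioo a b → DifferentiableAt ℂ E u) {K T : ℝ}
    (hK : ∀ u : ℂ, u.re ∈ Icc a b → T ≤ |u.im| → ‖E u‖ ≤ K / u.im ^ 2) :
    ∫ y : ℝ, E (a + y * I) = ∫ y : ℝ, E (b + y * I) := by
  have hint : ∀ x ∈ Icc a b, Integrable fun y : ℝ => E (x + y * I) := fun x hx =>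
    integrable_of_norm_le_div_sq (continuous_comp_vertical hc hx) (K := K) (T := T)
      (fun y hy => by simpa using hK (x + y * I) (by simpa using hx) (by simpa using hy))
  have hlim : ∀ x ∈ Icc a b, Tendsto (fun n : ℝ => ∫ y in (-n)..n, E (x + y * I)) atTop
      (𝓝 (∫ y : ℝ, E (x + y * I))) := fun x hx =>
    intervalIntegral_tendsto_integral (hint x hx) tendsto_neg_atTop_atBot tendsto_id
  have hedge : ∀ ε : ℝ → ℝ, (∀ n, |ε n| = |n|) →
      Tendsto (fun n : ℝ => ∫ x in a..b, E (x + ε n * I)) atTop (𝓝 0) := by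
    intro ε hε
    have hz : Tendsto (fun n : ℝ => K / n ^ 2 * |b - a|) atTop (𝓝 0) := by
      have : Tendsto (fun n : ℝ => K / n ^ 2) atTop (𝓝 0) :=
        tendsto_const_nhds.div_atTop (tendsto_pow_atTop two_ne_zero)
      simpa using this.mul_const |b - a|
    refine squeeze_zero_norm' ?_ hz
    filter_upwards [eventually_ge_atTop T, eventually_ge_atTop 0] with n hn hn0
    refine intervalIntegral.norm_integral_le_of_norm_le_const fun x hx => ?_
    rw [uIoc_of_le hab] at hx
    have := hK (x + ε n * I) (by simpa using ⟨hx.1.le, hx.2⟩)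
      (by simpa [hε] using hn.trans (le_abs_self n))
    refine this.trans_eq ?_
    simp only [add_im, ofReal_im, mul_im, ofReal_re, I_im, mul_one, I_re, mul_zero, add_zero,
      zero_add]
    rw [← sq_abs, hε, sq_abs]
  have hrect : ∀ n : ℝ, 0 ≤ n → (∫ y in (-n)..n, E (a + y * I)) - (∫ y in (-n)..n, E (b + y * I))
      = -I * ((∫ x in a..b, E (x + (-n : ℝ) * I)) - ∫ x in a..b, E (x + (n : ℝ) * I)) := by
    intro n hn
    have := integral_boundary_rect_eq_zero_of_continuousOn_of_differentiableOn E
      (a + (-n : ℝ) * I) (b + (n : ℝ) * I)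
      (hc.mono (fun u hu => by
        have := hu.1
        simpa [uIcc_of_le hab] using this))
      (fun u hu => (hd u (by
        have := hu.1
        simpa [min_eq_left hab, max_eq_right hab] using this)).differentiableWithinAt)
    simp only [add_re, ofReal_re, mul_re, I_re, mul_zero, ofReal_im, I_im, mul_one, sub_self,
      add_zero, add_im, mul_im, zero_add, smul_eq_mul] at this
    linear_combination I * this + ((∫ y in (-n)..n, E (a + y * I))
      - (∫ y in (-n)..n, E (b + y * I))) * I_sq
  have h1 := (hlim a (left_mem_Icc.2 hab)).sub (hlim b (right_mem_Icc.2 hab))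
  have h2 := ((hedge (fun n => -n) (fun n => abs_neg n)).sub
    (hedge (fun n => n) (fun n => rfl))).const_mul (-I)
  have h3 := h2.congr' (by
    filter_upwards [eventually_ge_atTop 0] with n hn using (hrect n hn).symm)
  have := tendsto_nhds_unique h1 h3
  simpa [sub_eq_zero] using this

/-! ### Elementary bounds for powers -/

theorem norm_ofReal_cpow {x : ℝ} (hx : 0 < x) (u : ℂ) : ‖(x : ℂ) ^ u‖ = x ^ u.re :=
  norm_cpow_eq_rpow_re_of_pos hx u

theorem rpow_le_rpow_add_rpow {a b x : ℝ} (ha : 0 < a) (hax : a ≤ x) (hxb : x ≤ b) (r : ℝ) :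
    x ^ r ≤ a ^ r + b ^ r := by
  have hx : 0 < x := ha.trans_le hax
  have hb : 0 < b := hx.trans_le hxb
  rcases le_total 0 r with hr | hr
  · exact (Real.rpow_le_rpow hx.le hxb hr).trans (by linarith [Real.rpow_pos_of_pos ha r])
  · exact (Real.rpow_le_rpow_of_nonpos ha hax hr).trans (by linarith [Real.rpow_pos_of_pos hb r])

/-- The increment of `x ^ u` over an interval of length one is controlled by the derivative. -/
theorem norm_one_add_cpow_sub_cpow_le {x B : ℝ} (hx : 0 < x) {u : ℂ}
    (hB : ∀ y ∈ Icc x (1 + x), y ^ (u.re - 1) ≤ B) :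
    ‖((1 + x : ℝ) : ℂ) ^ u - (x : ℂ) ^ u‖ ≤ ‖u‖ * B := by
  rcases eq_or_ne u 0 with rfl | hu
  · simp
  have := norm_image_sub_le_of_norm_deriv_le_segment' (f := fun y : ℝ => (y : ℂ) ^ u)
    (f' := fun y : ℝ => u * (y : ℂ) ^ (u - 1)) (a := x) (b := 1 + x) (C := ‖u‖ * B)
    (fun y hy => (hasDerivAt_ofReal_cpow_const (hx.trans_le hy.1).ne' hu).hasDerivWithinAt)
    (fun y hy => by
      rw [norm_mul, norm_ofReal_cpow (hx.trans_le hy.1)]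
      exact mul_le_mul_of_nonneg_left (by simpa using hB y ⟨hy.1, hy.2.le⟩) (norm_nonneg _))
    (1 + x) ⟨by linarith, le_rfl⟩
  simpa using this

theorem integral_pos_of_ae_pos {X : Type*} [MeasurableSpace X] {ν : Measure X} [NeZero ν]
    {f : X → ℝ} (hf : Integrable f ν) (hpos : ∀ᵐ x ∂ν, 0 < f x) : 0 < ∫ x, f x ∂ν := by
  rw [integral_pos_iff_support_of_nonneg_ae (hpos.mono fun _ h => h.le) hf]
  rw [pos_iff_ne_zero]
  intro h0
  have h1 : ∀ᵐ x ∂ν, x ∉ Function.support f := measure_eq_zero_iff_ae_notMem.1 h0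
  have h2 : ∀ᵐ x ∂ν, False := by
    filter_upwards [hpos, h1] with x hx hx'
    exact hx' hx.ne'
  exact (NeZero.ne ν) (by simpa using h2)

/-! ### The law of `Z` and its moment function -/

namespace IsAdmissibleLaw

variable {μ : Measure ℝ} {cm cp : ℝ}

theorem cp_pos (hμ : IsAdmissibleLaw μ cm cp) : 0 < cp := hμ.cm_pos.trans hμ.cm_lt_cp

theorem ae_mem_Icc (hμ : IsAdmissibleLaw μ cm cp) : ∀ᵐ z ∂μ, z ∈ Icc cm cp := by
  have := hμ.prob
  exact (prob_compl_eq_zero_iff measurableSet_Icc).2 hμ.mem_Icc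

theorem measure_singleton (hμ : IsAdmissibleLaw μ cm cp) (x : ℝ) : μ {x} = 0 := by
  obtain ⟨f, -, -, rfl⟩ := hμ.density
  exact withDensity_absolutelyContinuous _ _ Real.volume_singleton

theorem ae_ne (hμ : IsAdmissibleLaw μ cm cp) (x : ℝ) : ∀ᵐ z ∂μ, z ≠ x :=
  measure_eq_zero_iff_ae_notMem.1 (hμ.measure_singleton x)

/-- Integration by parts against the `C¹` density of `μ`: integrals of a derivative `κ'` are
controlled by the size of its primitive `κ`. -/
theorem exists_norm_integral_deriv_le (hμ : IsAdmissibleLaw μ cm cp) :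
    ∃ L : ℝ, 0 ≤ L ∧ ∀ (κ κ' : ℝ → ℂ) (B : ℝ),
      (∀ z ∈ Icc (cm / 2) (cp + 1), HasDerivAt κ (κ' z) z) →
      ContinuousOn κ' (Icc (cm / 2) (cp + 1)) →
      (∀ z ∈ Icc (cm / 2) (cp + 1), ‖κ z‖ ≤ B) → ‖∫ z, κ' z ∂μ‖ ≤ L * B := by
  have hcm := hμ.cm_pos
  have hlt := hμ.cm_lt_cp
  obtain ⟨f, hf, hf0, hμf⟩ := hμ.density
  have hmeas : Measurable fun z => ENNReal.ofReal (f z) := hf.continuous.measurable.ennreal_ofReal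
  have hzero : ∀ z ∉ Icc cm cp, f z = 0 := by
    have h1 : ∀ᵐ z ∂μ, z ∈ Icc cm cp := hμ.ae_mem_Icc
    rw [hμf, ae_withDensity_iff hmeas] at h1
    have h2 : f =ᵐ[volume.restrict (Icc cm cp)ᶜ] fun _ => 0 := by
      rw [EventuallyEq, ae_restrict_iff' measurableSet_Icc.compl]
      filter_upwards [h1] with z hz hz'
      by_contra hne
      exact hz' (hz (by simpa using lt_of_le_of_ne (hf0 z) (Ne.symm hne)))
    exact Measure.eqOn_open_of_ae_eq h2 isClosed_Icc.isOpen_compl hf.continuous.continuousOn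
      continuousOn_const
  have hab : cm / 2 ≤ cp + 1 := by linarith
  refine ⟨∫ z in (cm / 2)..(cp + 1), |deriv f z|,
    intervalIntegral.integral_nonneg hab fun z _ => abs_nonneg _, ?_⟩
  intro κ κ' B hκ hκ' hB
  have hdf : Continuous (deriv f) := hf.continuous_deriv le_rfl
  have hint : ∫ z, κ' z ∂μ = ∫ z in (cm / 2)..(cp + 1), (f z : ℂ) * κ' z := by
    rw [hμf, integral_withDensity_eq_integral_toReal_smul hmeas (by simp),
      intervalIntegral.integral_of_le hab, setIntegral_eq_integral_of_forall_compl_eq_zero]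
    · refine integral_congr_ae (Eventually.of_forall fun z => ?_)
      simp [ENNReal.toReal_ofReal (hf0 z)]
    · intro z hz
      rw [hzero z (fun h => hz ⟨by linarith [h.1], by linarith [h.2]⟩)]
      simp
  have hparts : ∫ z in (cm / 2)..(cp + 1), (f z : ℂ) * κ' z
      = - ∫ z in (cm / 2)..(cp + 1), ((deriv f z : ℝ) : ℂ) * κ z := by
    rw [intervalIntegral.integral_mul_deriv_eq_deriv_mul (u := fun z => (f z : ℂ))
      (u' := fun z => ((deriv f z : ℝ) : ℂ)) (v := κ)]
    · rw [hzero _ (fun h => by linarith [h.1] : cm / 2 ∉ Icc cm cp),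
        hzero _ (fun h => by linarith [h.2] : cp + 1 ∉ Icc cm cp)]
      simp
    · intro z _
      exact ((hf.differentiable one_ne_zero) z).hasDerivAt.ofReal_comp
    · intro z hz
      exact hκ z (by rwa [uIcc_of_le hab] at hz)
    · exact (continuous_ofReal.comp hdf).intervalIntegrable _ _
    · exact ContinuousOn.intervalIntegrable (by rwa [uIcc_of_le hab])
  rw [hint, hparts, norm_neg, ← intervalIntegral.integral_mul_const]
  refine intervalIntegral.norm_integral_le_of_norm_le hab (Eventually.of_forall fun z hz => ?_)
    ((hdf.abs.mul continuous_const).intervalIntegrable _ _)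
  rw [norm_mul, norm_real, Real.norm_eq_abs]
  exact mul_le_mul_of_nonneg_left (hB z ⟨hz.1.le, hz.2⟩) (abs_nonneg _)

theorem integrable_rpow (hμ : IsAdmissibleLaw μ cm cp) (r : ℝ) :
    Integrable (fun z : ℝ => z ^ r) μ := by
  have := hμ.prob
  refine Integrable.of_bound (by fun_prop) (cm ^ r + cp ^ r) ?_
  filter_upwards [hμ.ae_mem_Icc] with z hz
  rw [Real.norm_of_nonneg (Real.rpow_nonneg (hμ.cm_pos.le.trans hz.1) _)]
  exact rpow_le_rpow_add_rpow hμ.cm_pos hz.1 hz.2 r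

theorem norm_M_le (hμ : IsAdmissibleLaw μ cm cp) (u : ℂ) : ‖M μ u‖ ≤ ∫ z, z ^ u.re ∂μ := by
  refine (norm_integral_le_integral_norm _).trans_eq (integral_congr_ae ?_)
  filter_upwards [hμ.ae_mem_Icc] with z hz
  exact norm_ofReal_cpow (hμ.cm_pos.trans_le hz.1) u

theorem M_ofReal (hμ : IsAdmissibleLaw μ cm cp) (r : ℝ) :
    M μ r = ((∫ z, z ^ r ∂μ : ℝ) : ℂ) := by
  rw [M, ← integral_complex_ofReal]
  refine integral_congr_ae ?_
  filter_upwards [hμ.ae_mem_Icc] with z hz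
  exact (ofReal_cpow (hμ.cm_pos.le.trans hz.1) r).symm

/-- Moments of order between `0` and `α` are less than one, by strict concavity. -/
theorem integral_rpow_lt_one (hμ : IsAdmissibleLaw μ cm cp) {α σ : ℝ}
    (hMα : ∫ z, z ^ α ∂μ = 1) (hσ : 0 < σ) (hσα : σ < α) : ∫ z, z ^ σ ∂μ < 1 := by
  have := hμ.prob
  have hα : 0 < α := hσ.trans hσα
  have i1 : Integrable (fun z => z ^ α - 1) μ := (hμ.integrable_rpow α).sub (integrable_const _)
  have i2 : Integrable (fun z => 1 + σ / α * (z ^ α - 1)) μ :=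
    (integrable_const _).add (i1.const_mul _)
  have hpos : 0 < ∫ z, (1 + σ / α * (z ^ α - 1) - z ^ σ) ∂μ := by
    refine integral_pos_of_ae_pos ?_ ?_
    · exact i2.sub (hμ.integrable_rpow σ)
    · filter_upwards [hμ.ae_mem_Icc, hμ.ae_ne 1] with z hz hz1
      have hz0 : 0 < z := hμ.cm_pos.trans_le hz.1
      have hne : z ^ α - 1 ≠ 0 := fun h => hz1 <| by
        have h' : z ^ α = 1 ^ α := by rw [Real.one_rpow]; linarith
        exact (Real.rpow_left_inj hz0.le zero_le_one hα.ne').1 h'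
      have := rpow_one_add_lt_one_add_mul_self (s := z ^ α - 1) (p := σ / α)
        (by linarith [Real.rpow_pos_of_pos hz0 α]) hne (by positivity)
        ((div_lt_one hα).2 hσα)
      rw [add_sub_cancel, ← Real.rpow_mul hz0.le, mul_div_cancel₀ _ hα.ne'] at this
      linarith
  rw [integral_sub i2 (hμ.integrable_rpow σ), integral_add (integrable_const _) (i1.const_mul _),
    integral_const_mul, integral_sub (hμ.integrable_rpow α) (integrable_const _), hMα] at hpos
  simp at hpos
  exact hpos

theorem hasDerivAt_M (hμ : IsAdmissibleLaw μ cm cp) (u : ℂ) :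
    HasDerivAt (M μ) (∫ z : ℝ, (z : ℂ) ^ u * Real.log z ∂μ) u := by
  have := hμ.prob
  refine hasDerivAt_integral_of_norm_le isOpen_univ (F := fun u (z : ℝ) => (z : ℂ) ^ u)
    (F' := fun u (z : ℝ) => (z : ℂ) ^ u * Real.log z)
    (B := fun u => cm ^ u.re + cp ^ u.re) ?_ ?_ ?_ ?_ ?_ (mem_univ u)
  · exact ((continuous_const.rpow continuous_re fun _ => Or.inl hμ.cm_pos.ne').add
      (continuous_const.rpow continuous_re fun _ => Or.inl hμ.cp_pos.ne')).continuousOn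
  · intro u _
    exact (measurable_ofReal.pow_const u).aestronglyMeasurable
  · intro u _
    exact ((measurable_ofReal.pow_const u).mul
      (measurable_ofReal.comp Real.measurable_log)).aestronglyMeasurable
  · filter_upwards [hμ.ae_mem_Icc] with z hz u _
    have hz0 : 0 < z := hμ.cm_pos.trans_le hz.1
    have := (hasDerivAt_id u).const_cpow (c := (z : ℂ)) (Or.inl (by exact_mod_cast hz0.ne'))
    simpa [ofReal_log hz0.le] using this
  · filter_upwards [hμ.ae_mem_Icc] with z hz u _
    rw [norm_ofReal_cpow (hμ.cm_pos.trans_le hz.1)]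
    exact rpow_le_rpow_add_rpow hμ.cm_pos hz.1 hz.2 _

/-- The zero of `1 - M` at `α` is simple: `α M'(α) = E[Z ^ α log (Z ^ α)] > E[Z ^ α - 1] = 0`. -/
theorem exists_pos_integral_cpow_mul_log_eq (hμ : IsAdmissibleLaw μ cm cp) {α : ℝ} (hα : 0 < α)
    (hMα : ∫ z, z ^ α ∂μ = 1) :
    ∃ d : ℝ, 0 < d ∧ ∫ z : ℝ, (z : ℂ) ^ (α : ℂ) * Real.log z ∂μ = d := by
  have := hμ.prob
  have hcast : ∫ z : ℝ, (z : ℂ) ^ (α : ℂ) * Real.log z ∂μ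
      = ((∫ z, z ^ α * Real.log z ∂μ : ℝ) : ℂ) := by
    rw [← integral_complex_ofReal]
    refine integral_congr_ae ?_
    filter_upwards [hμ.ae_mem_Icc] with z hz
    rw [ofReal_mul, ofReal_cpow (hμ.cm_pos.le.trans hz.1)]
  refine ⟨_, ?_, hcast⟩
  have hint : Integrable (fun z : ℝ => z ^ α * Real.log z) μ := by
    refine Integrable.of_bound (by fun_prop)
      ((cm ^ α + cp ^ α) * (|Real.log cm| + |Real.log cp|)) ?_
    filter_upwards [hμ.ae_mem_Icc] with z hz
    have hz0 : 0 < z := hμ.cm_pos.trans_le hz.1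
    rw [norm_mul, Real.norm_of_nonneg (Real.rpow_nonneg hz0.le _), Real.norm_eq_abs]
    have h1 := Real.log_le_log hμ.cm_pos hz.1
    have h2 := Real.log_le_log hz0 hz.2
    refine mul_le_mul (rpow_le_rpow_add_rpow hμ.cm_pos hz.1 hz.2 α) ?_ (abs_nonneg _) ?_
    · rw [abs_le]
      constructor <;> linarith [neg_abs_le (Real.log cm), le_abs_self (Real.log cp),
        abs_nonneg (Real.log cm), abs_nonneg (Real.log cp)]
    · exact add_nonneg (Real.rpow_nonneg hμ.cm_pos.le _) (Real.rpow_nonneg hμ.cp_pos.le _)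
  have i1 : Integrable (fun z => z ^ α - 1) μ := (hμ.integrable_rpow α).sub (integrable_const _)
  have hpos : 0 < ∫ z, (α * (z ^ α * Real.log z) - (z ^ α - 1)) ∂μ := by
    refine integral_pos_of_ae_pos ((hint.const_mul _).sub i1) ?_
    filter_upwards [hμ.ae_mem_Icc, hμ.ae_ne 1] with z hz hz1
    have hz0 : 0 < z := hμ.cm_pos.trans_le hz.1
    have hp := Real.rpow_pos_of_pos hz0 α
    have hne : (z ^ α)⁻¹ ≠ 1 := fun h => hz1 <| by
      have h' : z ^ α = 1 ^ α := by rw [Real.one_rpow]; exact inv_eq_one.1 h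
      exact (Real.rpow_left_inj hz0.le zero_le_one hα.ne').1 h'
    have h1 := Real.log_lt_sub_one_of_pos (inv_pos.2 hp) hne
    rw [Real.log_inv, Real.log_rpow hz0] at h1
    have h2 := mul_lt_mul_of_pos_left h1 hp
    rw [mul_sub, mul_inv_cancel₀ hp.ne'] at h2
    linarith
  rw [integral_sub (hint.const_mul _) i1,
    integral_const_mul, integral_sub (hμ.integrable_rpow α) (integrable_const _), hMα] at hpos
  simp only [integral_const, probReal_univ, smul_eq_mul, mul_one, sub_self, sub_zero] at hpos
  exact pos_of_mul_pos_right hpos hα.le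

/-- The moment function decays like `1 / |u|` on vertical strips. -/
theorem exists_norm_M_mul_le (hμ : IsAdmissibleLaw μ cm cp) :
    ∃ K : ℝ, ∀ u : ℂ, 0 ≤ u.re → u.re ≤ 1 → ‖M μ u‖ * ‖u + 1‖ ≤ K := by
  have hcm := hμ.cm_pos
  have hcp := hμ.cp_pos
  obtain ⟨L, hL, h⟩ := hμ.exists_norm_integral_deriv_le
  refine ⟨L * (cp + 1) ^ (2 : ℝ), fun u hu0 hu1 => ?_⟩
  have hne : u + 1 ≠ 0 := fun h0 => by
    have := congrArg re h0
    simp at this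
    linarith
  have hn : 0 < ‖u + 1‖ := norm_pos_iff.2 hne
  rw [← le_div_iff₀ hn, mul_div_assoc]
  refine h (fun z : ℝ => (z : ℂ) ^ (u + 1) / (u + 1)) _ _ ?_ ?_ ?_
  · intro z hz
    exact hasDerivAt_ofReal_cpow_const' (by linarith [hz.1]) (fun h0 => hne (by simp [h0]))
  · intro z hz
    refine ContinuousAt.continuousWithinAt ?_
    exact continuousAt_ofReal_cpow_const _ _ (Or.inr (by linarith [hz.1]))
  · intro z hz
    have hz0 : 0 < z := by linarith [hz.1]
    rw [norm_div, norm_ofReal_cpow hz0]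
    gcongr
    calc z ^ (u + 1).re ≤ (cp + 1) ^ (u + 1).re :=
          Real.rpow_le_rpow hz0.le hz.2 (by simp; linarith)
      _ ≤ (cp + 1) ^ (2 : ℝ) :=
          Real.rpow_le_rpow_of_exponent_le (by linarith) (by simp; linarith)

/-- Averaging over `Z` makes the increments of `x ↦ x ^ u` bounded, uniformly in `Im u`. -/
theorem exists_norm_integral_increment_le (hμ : IsAdmissibleLaw μ cm cp) :
    ∃ K : ℝ, ∀ u : ℂ, 0 ≤ u.re → u.re ≤ 1 → ∀ w : ℝ, 1 ≤ w →
      ‖∫ z : ℝ, (((1 + z * w : ℝ) : ℂ) ^ u - ((z * w : ℝ) : ℂ) ^ u) ∂μ‖ ≤ K := by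
  have hcm := hμ.cm_pos
  have hcp := hμ.cp_pos
  obtain ⟨L, hL, h⟩ := hμ.exists_norm_integral_deriv_le
  refine ⟨L * (cp + 2), fun u hu0 hu1 w hw => ?_⟩
  have hw0 : 0 < w := by linarith
  have hne : u + 1 ≠ 0 := fun h0 => by
    have := congrArg re h0
    simp at this
    linarith
  have hn : 0 < ‖u + 1‖ := norm_pos_iff.2 hne
  have hne' : u ≠ -1 := fun h0 => hne (by simp [h0])
  refine h (fun z : ℝ => (((1 + z * w : ℝ) : ℂ) ^ (u + 1) / (u + 1)
    - ((z * w : ℝ) : ℂ) ^ (u + 1) / (u + 1)) / w) _ _ ?_ ?_ ?_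
  · intro z hz
    have hz0 : 0 < z := by linarith [hz.1]
    have hzw : 0 < z * w := by positivity
    have h1 : HasDerivAt (fun z : ℝ => z * w) w z := by
      simpa using (hasDerivAt_id z).mul_const w
    have h2 := (hasDerivAt_ofReal_cpow_const' hzw.ne' hne').scomp z h1
    have h3 := (hasDerivAt_ofReal_cpow_const' (x := 1 + z * w) (by positivity) hne').scomp z
      (h1.const_add 1)
    have h4 := (h3.sub h2).div_const (w : ℂ)
    refine h4.congr_deriv ?_
    simp only [real_smul]
    have : (w : ℂ) ≠ 0 := by exact_mod_cast hw0.ne'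
    field_simp
  · intro z hz
    have hz0 : 0 < z := by linarith [hz.1]
    have hzw : 0 < z * w := by positivity
    refine ContinuousAt.continuousWithinAt (ContinuousAt.sub ?_ ?_)
    · exact (continuousAt_ofReal_cpow_const (1 + z * w) u (Or.inr (by positivity))).comp
        (f := fun z : ℝ => 1 + z * w) (by fun_prop)
    · exact (continuousAt_ofReal_cpow_const (z * w) u (Or.inr hzw.ne')).comp
        (f := fun z : ℝ => z * w) (by fun_prop)
  · intro z hz
    have hz0 : 0 < z := by linarith [hz.1]
    have hzw : 0 < z * w := by positivity
    have h1 := norm_one_add_cpow_sub_cpow_le hzw (u := u + 1) (B := 1 + z * w) (fun y hy => by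
      have hy0 : 0 < y := hzw.trans_le hy.1
      simp only [add_re, one_re, add_sub_cancel_right]
      calc y ^ u.re ≤ (1 + z * w) ^ u.re := Real.rpow_le_rpow hy0.le hy.2 hu0
        _ ≤ (1 + z * w) ^ (1 : ℝ) := Real.rpow_le_rpow_of_exponent_le (by linarith) hu1
        _ = 1 + z * w := Real.rpow_one _)
    rw [← sub_div, norm_div, norm_div, norm_real, Real.norm_of_nonneg hw0.le, div_div,
      div_le_iff₀ (by positivity)]
    refine h1.trans ?_
    have : 1 + z * w ≤ (cp + 2) * w := by nlinarith [hz.2]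
    nlinarith

end IsAdmissibleLaw

/-! ### The stationary law -/

/-- The complex moment of order `u` of the increment from `s` to `1 + s`:
`∫ ((1 + s) ^ u - s ^ u) ν(ds)`. Unlike the moment of `s` itself, it is finite up to
`Re u = 1`. -/
noncomputable def incrementMoment (ν : Measure ℝ) (u : ℂ) : ℂ :=
  ∫ s : ℝ, (((1 + s : ℝ) : ℂ) ^ u - (s : ℂ) ^ u) ∂ν

namespace IsStationary

variable {μ ν : Measure ℝ} {cm cp : ℝ}

theorem map_eq (hν : IsStationary μ ν) :
    (ν.prod μ).map (fun p : ℝ × ℝ => p.2 * (1 + p.1)) = ν := by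
  simpa [T, g] using hν.fixed

theorem ae_pos (hν : IsStationary μ ν) : ∀ᵐ s ∂ν, 0 < s := by
  filter_upwards [measure_eq_zero_iff_ae_notMem.1 hν.support] with s hs
  simpa using hs

theorem ae_le (hμ : IsAdmissibleLaw μ cm cp) (hν : IsStationary μ ν) : ∀ᵐ s ∂ν, cm ≤ s := by
  have := hμ.prob
  have := hν.prob
  rw [← hν.map_eq, ae_map_iff (by fun_prop) measurableSet_Ici]
  have h1 : ∀ᵐ p ∂ν.prod μ, 0 < p.1 := Measure.quasiMeasurePreserving_fst.ae hν.ae_pos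
  have h2 : ∀ᵐ p ∂ν.prod μ, p.2 ∈ Icc cm cp :=
    Measure.quasiMeasurePreserving_snd.ae hμ.ae_mem_Icc
  filter_upwards [h1, h2] with p hp1 hp2
  nlinarith [hp2.1, hμ.cm_pos]

theorem measure_singleton (hμ : IsAdmissibleLaw μ cm cp) (hν : IsStationary μ ν) (x : ℝ) :
    ν {x} = 0 := by
  have := hμ.prob
  have := hν.prob
  have hm : Measurable fun p : ℝ × ℝ => p.2 * (1 + p.1) := by fun_prop
  rw [← hν.map_eq, Measure.map_apply hm (MeasurableSet.singleton x),
    Measure.measure_prod_null (hm (MeasurableSet.singleton x))]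
  filter_upwards [hν.ae_pos] with s hs
  refine measure_mono_null (fun z hz => ?_) (hμ.measure_singleton (x / (1 + s)))
  have hz' : z * (1 + s) = x := hz
  rw [mem_singleton_iff, eq_div_iff (by positivity), hz']

theorem lintegral_eq (hμ : IsAdmissibleLaw μ cm cp) (hν : IsStationary μ ν) {k : ℝ → ENNReal}
    (hk : Measurable k) : ∫⁻ s, k s ∂ν = ∫⁻ y, ∫⁻ z, k (z * (1 + y)) ∂μ ∂ν := by
  have := hμ.prob
  have := hν.prob
  conv_lhs => rw [← hν.map_eq]
  rw [lintegral_map hk (by fun_prop), lintegral_prod]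
  exact (hk.comp (by fun_prop)).aemeasurable

theorem integral_eq (hμ : IsAdmissibleLaw μ cm cp) (hν : IsStationary μ ν) {k : ℝ → ℂ}
    (hk : Integrable k ν) : ∫ s, k s ∂ν = ∫ y, ∫ z, k (z * (1 + y)) ∂μ ∂ν := by
  have := hμ.prob
  have := hν.prob
  have hk' : Integrable k ((ν.prod μ).map (fun p : ℝ × ℝ => p.2 * (1 + p.1))) := by
    rwa [hν.map_eq]
  have hf : AEMeasurable (fun p : ℝ × ℝ => p.2 * (1 + p.1)) (ν.prod μ) := by fun_prop
  conv_lhs => rw [← hν.map_eq]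
  rw [integral_map hf hk'.aestronglyMeasurable]
  exact integral_prod (fun p : ℝ × ℝ => k (p.2 * (1 + p.1)))
    ((integrable_map_measure hk'.aestronglyMeasurable hf).1 hk')

/-- One step of the chain bounds a truncated moment by the same truncated moment with the factor
in front contracted by `m = E[Z ^ σ]`. -/
theorem lintegral_min_le (hμ : IsAdmissibleLaw μ cm cp) (hν : IsStationary μ ν) {σ : ℝ}
    (hσ : 0 < σ) (hσ1 : σ ≤ 1) {m : ENNReal} (hm : m = ∫⁻ z, ENNReal.ofReal (z ^ σ) ∂μ)
    (r K : ENNReal) :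
    ∫⁻ s, min (r * ENNReal.ofReal (s ^ σ)) K ∂ν
      ≤ r * m + ∫⁻ s, min (r * m * ENNReal.ofReal (s ^ σ)) K ∂ν := by
  have := hμ.prob
  have := hν.prob
  have he : Measurable fun s : ℝ => ENNReal.ofReal (s ^ σ) := by fun_prop
  rw [lintegral_eq hμ hν (k := fun s => min (r * ENNReal.ofReal (s ^ σ)) K) (by fun_prop)]
  have key : ∀ᵐ y ∂ν, ∫⁻ z, min (r * ENNReal.ofReal ((z * (1 + y)) ^ σ)) K ∂μ
      ≤ r * m + min (r * m * ENNReal.ofReal (y ^ σ)) K := by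
    filter_upwards [hν.ae_pos] with y hy
    calc ∫⁻ z, min (r * ENNReal.ofReal ((z * (1 + y)) ^ σ)) K ∂μ
        ≤ ∫⁻ z, (r * ENNReal.ofReal (z ^ σ)
            + min (r * ENNReal.ofReal (z ^ σ) * ENNReal.ofReal (y ^ σ)) K) ∂μ := by
          refine lintegral_mono_ae ?_
          filter_upwards [hμ.ae_mem_Icc] with z hz
          have hz0 : 0 < z := hμ.cm_pos.trans_le hz.1
          have h1 : ENNReal.ofReal ((z * (1 + y)) ^ σ)
              ≤ ENNReal.ofReal (z ^ σ) + ENNReal.ofReal (z ^ σ) * ENNReal.ofReal (y ^ σ) := by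
            rw [← ENNReal.ofReal_mul (by positivity), ← ENNReal.ofReal_add (by positivity)
              (by positivity)]
            refine ENNReal.ofReal_le_ofReal ?_
            rw [Real.mul_rpow hz0.le (by positivity)]
            have := Real.rpow_add_le_add_rpow zero_le_one hy.le hσ.le hσ1
            rw [Real.one_rpow] at this
            nlinarith [Real.rpow_pos_of_pos hz0 σ]
          calc min (r * ENNReal.ofReal ((z * (1 + y)) ^ σ)) K
              ≤ min (r * ENNReal.ofReal (z ^ σ)
                + r * ENNReal.ofReal (z ^ σ) * ENNReal.ofReal (y ^ σ)) K := by
                refine min_le_min_right _ ?_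
                rw [mul_assoc, ← mul_add]
                gcongr
            _ ≤ _ := by
                rcases le_total (r * ENNReal.ofReal (z ^ σ) * ENNReal.ofReal (y ^ σ)) K with h | h
                · rw [min_eq_left h]
                  exact min_le_left _ _
                · rw [min_eq_right h]
                  exact (min_le_right _ _).trans le_add_self
      _ = r * m + ∫⁻ z, min (r * ENNReal.ofReal (z ^ σ) * ENNReal.ofReal (y ^ σ)) K ∂μ := by
          rw [lintegral_add_left (by fun_prop), lintegral_const_mul _ he, hm]
      _ ≤ _ := by
          gcongr
          refine le_min ?_ ?_
          · refine (lintegral_mono fun z => min_le_left _ _).trans_eq ?_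
            rw [lintegral_mul_const _ (by fun_prop), lintegral_const_mul _ he, hm]
          · refine (lintegral_mono fun z => min_le_right _ _).trans_eq ?_
            simp
  refine (lintegral_mono_ae key).trans_eq ?_
  rw [lintegral_add_left measurable_const]
  simp

theorem lintegral_rpow_lt_top (hμ : IsAdmissibleLaw μ cm cp) (hν : IsStationary μ ν) {σ : ℝ}
    (hσ : 0 < σ) (hσ1 : σ ≤ 1) (hM : ∫ z, z ^ σ ∂μ < 1) :
    ∫⁻ s, ENNReal.ofReal (s ^ σ) ∂ν < ⊤ := by
  have := hμ.prob
  have := hν.prob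
  obtain ⟨m, hm⟩ : ∃ m, m = ∫⁻ z, ENNReal.ofReal (z ^ σ) ∂μ := ⟨_, rfl⟩
  have hm1 : m < 1 := by
    rw [hm, ← ofReal_integral_eq_lintegral_ofReal (hμ.integrable_rpow σ)]
    · simpa using hM
    · filter_upwards [hμ.ae_mem_Icc] with z hz
      exact Real.rpow_nonneg (hμ.cm_pos.le.trans hz.1) _
  have he : Measurable fun s : ℝ => ENNReal.ofReal (s ^ σ) := by fun_prop
  have hiter : ∀ (K : ENNReal) (n : ℕ), ∫⁻ s, min (ENNReal.ofReal (s ^ σ)) K ∂ν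
      ≤ ∑ i ∈ Finset.range n, m ^ (i + 1) + ∫⁻ s, min (m ^ n * ENNReal.ofReal (s ^ σ)) K ∂ν := by
    intro K n
    induction n with
    | zero => simp
    | succ n ih =>
      refine ih.trans ?_
      rw [Finset.sum_range_succ, add_assoc, pow_succ m n]
      gcongr
      exact lintegral_min_le hμ hν hσ hσ1 hm _ _
  have hbound : ∀ K : ℕ, ∫⁻ s, min (ENNReal.ofReal (s ^ σ)) K ∂ν ≤ (1 - m)⁻¹ := by
    intro K
    have hlim : Tendsto (fun n : ℕ => ∫⁻ s, min (m ^ n * ENNReal.ofReal (s ^ σ)) (K : ENNReal) ∂ν)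
        atTop (𝓝 0) := by
      have := tendsto_lintegral_of_dominated_convergence (μ := ν)
        (F := fun (n : ℕ) s => min (m ^ n * ENNReal.ofReal (s ^ σ)) (K : ENNReal))
        (f := fun _ => 0) (fun _ => (K : ENNReal)) (fun n => by fun_prop)
        (fun n => Eventually.of_forall fun s => min_le_right _ _) (by simp)
        (Eventually.of_forall fun s => by
          have h1 := ENNReal.Tendsto.mul_const (ENNReal.tendsto_pow_atTop_nhds_zero_of_lt_one hm1)
            (b := ENNReal.ofReal (s ^ σ)) (Or.inr ENNReal.ofReal_ne_top)
          rw [zero_mul] at h1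
          exact tendsto_of_tendsto_of_tendsto_of_le_of_le tendsto_const_nhds h1
            (fun _ => bot_le) (fun _ => min_le_left _ _))
      simpa using this
    refine ge_of_tendsto' (x := atTop) (by simpa using hlim.const_add (1 - m)⁻¹) fun n => ?_
    refine (hiter K n).trans ?_
    gcongr
    calc ∑ i ∈ Finset.range n, m ^ (i + 1) ≤ ∑ i ∈ Finset.range n, m ^ i :=
          Finset.sum_le_sum fun i _ => pow_le_pow_of_le_one zero_le hm1.le (Nat.le_succ i)
      _ ≤ ∑' i, m ^ i := ENNReal.sum_le_tsum _
      _ = (1 - m)⁻¹ := ENNReal.tsum_geometric m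
  have hsup : ∫⁻ s, ENNReal.ofReal (s ^ σ) ∂ν
      = ⨆ K : ℕ, ∫⁻ s, min (ENNReal.ofReal (s ^ σ)) K ∂ν := by
    rw [← lintegral_iSup (fun K => by fun_prop) (fun i j hij s => by
      exact min_le_min_left _ (by exact_mod_cast hij))]
    refine lintegral_congr fun s => ?_
    refine le_antisymm ?_ (iSup_le fun K => min_le_left _ _)
    obtain ⟨n, hn⟩ := ENNReal.exists_nat_gt (ENNReal.ofReal_ne_top (r := s ^ σ))
    exact le_iSup_of_le n (by rw [min_eq_left hn.le])
  rw [hsup]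
  refine (iSup_le hbound).trans_lt ?_
  rw [ENNReal.inv_lt_top]
  exact tsub_pos_of_lt hm1

theorem integrable_rpow (hμ : IsAdmissibleLaw μ cm cp) (hν : IsStationary μ ν) {σ : ℝ}
    (hσ : 0 < σ) (hσ1 : σ ≤ 1) (hM : ∫ z, z ^ σ ∂μ < 1) :
    Integrable (fun s : ℝ => s ^ σ) ν := by
  refine ⟨by fun_prop, ?_⟩
  rw [hasFiniteIntegral_iff_ofReal]
  · exact lintegral_rpow_lt_top hμ hν hσ hσ1 hM
  · filter_upwards [hν.ae_pos] with s hs using Real.rpow_nonneg hs.le _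

theorem integrable_cpow (hμ : IsAdmissibleLaw μ cm cp) (hν : IsStationary μ ν) {u : ℂ}
    (hu : 0 < u.re) (hu1 : u.re ≤ 1) (hM : ∫ z, z ^ u.re ∂μ < 1) :
    Integrable (fun s : ℝ => (s : ℂ) ^ u) ν := by
  refine (integrable_rpow hμ hν hu hu1 hM).mono
    (measurable_ofReal.pow_const u).aestronglyMeasurable ?_
  filter_upwards [hν.ae_pos] with s hs
  rw [norm_ofReal_cpow hs]
  exact le_abs_self _

/-! ### The increment moment -/

theorem norm_increment_le (hμ : IsAdmissibleLaw μ cm cp) (hν : IsStationary μ ν) :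
    ∀ᵐ s : ℝ ∂ν, ∀ u : ℂ, u.re ≤ 1 →
      ‖((1 + s : ℝ) : ℂ) ^ u - (s : ℂ) ^ u‖ ≤ ‖u‖ * cm ^ (u.re - 1) := by
  filter_upwards [ae_le hμ hν] with s hs u hu
  exact norm_one_add_cpow_sub_cpow_le (hμ.cm_pos.trans_le hs) fun y hy =>
    Real.rpow_le_rpow_of_nonpos hμ.cm_pos (hs.trans hy.1) (by linarith)

theorem aestronglyMeasurable_increment (ν : Measure ℝ) (u : ℂ) :
    AEStronglyMeasurable (fun s : ℝ => ((1 + s : ℝ) : ℂ) ^ u - (s : ℂ) ^ u) ν :=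
  (((measurable_ofReal.comp (measurable_const_add 1)).pow_const u).sub
    (measurable_ofReal.pow_const u)).aestronglyMeasurable

theorem integrable_increment (hμ : IsAdmissibleLaw μ cm cp) (hν : IsStationary μ ν) {u : ℂ}
    (hu : u.re ≤ 1) : Integrable (fun s : ℝ => ((1 + s : ℝ) : ℂ) ^ u - (s : ℂ) ^ u) ν := by
  have := hν.prob
  refine Integrable.of_bound (aestronglyMeasurable_increment ν u) (‖u‖ * cm ^ (u.re - 1)) ?_
  filter_upwards [norm_increment_le hμ hν] with s hs using hs u hu

theorem continuous_increment_bound (hμ : IsAdmissibleLaw μ cm cp) :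
    Continuous fun u : ℂ => ‖u‖ * cm ^ (u.re - 1) :=
  continuous_norm.mul (continuous_const.rpow (by fun_prop) fun _ => Or.inl hμ.cm_pos.ne')

theorem differentiableAt_incrementMoment (hμ : IsAdmissibleLaw μ cm cp) (hν : IsStationary μ ν)
    {u : ℂ} (hu : u.re < 1) : DifferentiableAt ℂ (incrementMoment ν) u := by
  have := hν.prob
  refine (hasDerivAt_integral_of_norm_le (isOpen_lt continuous_re continuous_const)
    (F := fun u (s : ℝ) => ((1 + s : ℝ) : ℂ) ^ u - (s : ℂ) ^ u)
    (F' := fun u (s : ℝ) => ((1 + s : ℝ) : ℂ) ^ u * Real.log (1 + s) - (s : ℂ) ^ u * Real.log s)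
    (B := fun u => ‖u‖ * cm ^ (u.re - 1)) (continuous_increment_bound hμ).continuousOn
    (fun v _ => aestronglyMeasurable_increment ν v) ?_ ?_ ?_ hu).differentiableAt
  · intro v _
    refine Measurable.aestronglyMeasurable (Measurable.sub ?_ ?_)
    · exact ((measurable_ofReal.comp (measurable_const_add 1)).pow_const v).mul
        (measurable_ofReal.comp (Real.measurable_log.comp (measurable_const_add 1)))
    · exact (measurable_ofReal.pow_const v).mul (measurable_ofReal.comp Real.measurable_log)
  · have hd : ∀ (x : ℝ) (v : ℂ), 0 < x →
        HasDerivAt (fun v => (x : ℂ) ^ v) ((x : ℂ) ^ v * Real.log x) v := fun x v hx => by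
      have := (hasDerivAt_id v).const_cpow (c := (x : ℂ)) (Or.inl (by exact_mod_cast hx.ne'))
      simpa [ofReal_log hx.le] using this
    filter_upwards [hν.ae_pos] with s hs v _
    exact (hd (1 + s) v (by positivity)).sub (hd s v hs)
  · filter_upwards [norm_increment_le hμ hν] with s hs v hv using hs v (le_of_lt hv)

theorem continuousOn_incrementMoment (hμ : IsAdmissibleLaw μ cm cp) (hν : IsStationary μ ν) :
    ContinuousOn (incrementMoment ν) {u | u.re ≤ 1} := by
  have := hν.prob
  intro u hu
  have hB := continuous_increment_bound hμ
  refine continuousWithinAt_of_dominated (bound := fun _ => ‖u‖ * cm ^ (u.re - 1) + 1)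
    (Eventually.of_forall fun v => aestronglyMeasurable_increment ν v) ?_ (integrable_const _) ?_
  · filter_upwards [self_mem_nhdsWithin, nhdsWithin_le_nhds
      (hB.continuousAt.eventually_lt (continuousAt_const (x := u)) (lt_add_one _))] with v hv hv'
    filter_upwards [norm_increment_le hμ hν] with s hs
    exact (hs v hv).trans hv'.le
  · filter_upwards [hν.ae_pos] with s hs
    refine ContinuousAt.continuousWithinAt (ContinuousAt.sub ?_ ?_)
    · exact continuousAt_const_cpow (by exact_mod_cast (by positivity : 1 + s ≠ 0))
    · exact continuousAt_const_cpow (by exact_mod_cast hs.ne')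

/-- Stationarity replaces `s` by `Z (1 + s)`, whose smoothness bounds the increment moment. -/
theorem exists_norm_incrementMoment_le (hμ : IsAdmissibleLaw μ cm cp) (hν : IsStationary μ ν) :
    ∃ K : ℝ, ∀ u : ℂ, 0 ≤ u.re → u.re ≤ 1 → ‖incrementMoment ν u‖ ≤ K := by
  have := hν.prob
  obtain ⟨K, hK⟩ := hμ.exists_norm_integral_increment_le
  refine ⟨K, fun u hu0 hu1 => ?_⟩
  rw [incrementMoment, integral_eq hμ hν (integrable_increment hμ hν hu1)]
  refine (norm_integral_le_of_norm_le_const (C := K) ?_).trans_eq (by simp)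
  filter_upwards [hν.ae_pos] with y hy
  exact hK u hu0 hu1 (1 + y) (by linarith)

theorem exists_pos_incrementMoment_eq (hμ : IsAdmissibleLaw μ cm cp) (hν : IsStationary μ ν)
    {α : ℝ} (hα : 0 < α) (hα1 : α ≤ 1) : ∃ c : ℝ, 0 < c ∧ incrementMoment ν α = c := by
  have := hν.prob
  have hae : (fun s : ℝ => ((1 + s : ℝ) : ℂ) ^ (α : ℂ) - (s : ℂ) ^ (α : ℂ)) =ᵐ[ν]
      fun s => (((1 + s) ^ α - s ^ α : ℝ) : ℂ) := by
    filter_upwards [hν.ae_pos] with s hs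
    rw [ofReal_sub, ofReal_cpow hs.le, ofReal_cpow (by positivity)]
  have hint := integrable_increment hμ hν (u := (α : ℂ)) (by simpa using hα1)
  rw [incrementMoment, integral_congr_ae hae, integral_complex_ofReal]
  refine ⟨_, integral_pos_of_ae_pos ?_ ?_, rfl⟩
  · simpa using (hint.congr hae).re
  · filter_upwards [hν.ae_pos] with s hs
    exact sub_pos.2 (Real.rpow_lt_rpow hs.le (by linarith) hα)

/-- The stationarity equation for moments. -/
theorem integral_cpow_mul (hμ : IsAdmissibleLaw μ cm cp) (hν : IsStationary μ ν) {u : ℂ}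
    (hu : 0 < u.re) (hu1 : u.re ≤ 1) (hM : ∫ z, z ^ u.re ∂μ < 1) :
    (∫ s : ℝ, (s : ℂ) ^ u ∂ν) * (1 - M μ u) = M μ u * incrementMoment ν u := by
  have hint := integrable_cpow hμ hν hu hu1 hM
  have hinc := integrable_increment hμ hν hu1
  have h1 : ∫ s : ℝ, (s : ℂ) ^ u ∂ν = M μ u * ∫ s : ℝ, ((1 + s : ℝ) : ℂ) ^ u ∂ν := by
    rw [integral_eq hμ hν hint, ← integral_const_mul]
    refine integral_congr_ae ?_
    filter_upwards [hν.ae_pos] with y hy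
    rw [M, ← integral_mul_const]
    refine integral_congr_ae ?_
    filter_upwards [hμ.ae_mem_Icc] with z hz
    rw [ofReal_mul, mul_cpow_ofReal_nonneg (hμ.cm_pos.le.trans hz.1) (by positivity)]
  have h2 : ∫ s : ℝ, ((1 + s : ℝ) : ℂ) ^ u ∂ν
      = incrementMoment ν u + ∫ s : ℝ, (s : ℂ) ^ u ∂ν := by
    rw [incrementMoment, ← integral_add hinc hint]
    simp
  rw [h2] at h1
  linear_combination h1

/-! ### The tail function -/

theorem continuous_G (hμ : IsAdmissibleLaw μ cm cp) (hν : IsStationary μ ν) :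
    Continuous (G ν) := by
  have := hν.prob
  have h : G ν = fun t => 1 - ProbabilityTheory.cdf ν t := by
    ext t
    rw [G, ProbabilityTheory.cdf_eq_real, ← compl_Iic, probReal_compl_eq_one_sub measurableSet_Iic]
  rw [h]
  refine continuous_const.sub (continuous_iff_continuousAt.2 fun t => ?_)
  rw [(ProbabilityTheory.cdf ν).mono.continuousAt_iff_leftLim_eq_rightLim,
    StieltjesFunction.rightLim_eq]
  refine le_antisymm ((ProbabilityTheory.cdf ν).mono.leftLim_le le_rfl) ?_
  have h1 := (ProbabilityTheory.cdf ν).measure_singleton t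
  rw [ProbabilityTheory.measure_cdf, measure_singleton hμ hν, eq_comm, ENNReal.ofReal_eq_zero] at h1
  linarith

theorem hasMellin_G (hν : IsStationary μ ν) {u : ℂ}
    (hu : 0 < u.re) (hint : Integrable (fun s : ℝ => s ^ u.re) ν) :
    HasMellin (fun t => (G ν t : ℂ)) u ((∫ s : ℝ, (s : ℂ) ^ u ∂ν) / u) := by
  have := hν.prob
  have hu0 : u ≠ 0 := fun h => by simp [h] at hu
  set F : ℝ × ℝ → ℂ := {p : ℝ × ℝ | p.1 < p.2}.indicator fun p => (p.1 : ℂ) ^ (u - 1) with hF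
  have hS : MeasurableSet {p : ℝ × ℝ | p.1 < p.2} := measurableSet_lt measurable_fst measurable_snd
  have hFm : AEStronglyMeasurable F ((volume.restrict (Ioi 0)).prod ν) :=
    (((measurable_ofReal.comp measurable_fst).pow_const (u - 1)).indicator hS).aestronglyMeasurable
  have hFs : ∀ s : ℝ, (fun t => F (t, s)) = (Iio s).indicator fun t : ℝ => (t : ℂ) ^ (u - 1) := by
    intro s
    ext t
    simp [hF, indicator]
  have hFt : ∀ t : ℝ, ∫ s, F (t, s) ∂ν = (t : ℂ) ^ (u - 1) • (G ν t : ℂ) := by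
    intro t
    have : (fun s => F (t, s)) = (Ioi t).indicator fun _ : ℝ => (t : ℂ) ^ (u - 1) := by
      ext s
      simp [hF, indicator]
    rw [this, integral_indicator_const _ measurableSet_Ioi, G, smul_eq_mul, mul_comm]
    rfl
  have hre : -1 < (u - 1).re := by simpa using hu
  have hIoo : ∀ s : ℝ, Iio s ∩ Ioi 0 = Ioo 0 s := fun s => by ext; simp [and_comm]
  have hFint : Integrable F ((volume.restrict (Ioi 0)).prod ν) := by
    rw [integrable_prod_iff' hFm]
    constructor
    · filter_upwards [hν.ae_pos] with s hs
      rw [hFs, integrable_indicator_iff measurableSet_Iio, IntegrableOn,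
        Measure.restrict_restrict measurableSet_Iio, hIoo]
      have := intervalIntegral.intervalIntegrable_cpow' (a := 0) (b := s) hre
      rw [intervalIntegrable_iff_integrableOn_Ioo_of_le hs.le] at this
      exact this
    · refine (hint.div_const u.re).congr ?_
      filter_upwards [hν.ae_pos] with s hs
      have h1 : (fun t => ‖F (t, s)‖) = (Iio s).indicator fun t : ℝ => ‖(t : ℂ) ^ (u - 1)‖ := by
        ext t
        rw [← norm_indicator_eq_indicator_norm, ← hFs]
      rw [h1, integral_indicator measurableSet_Iio, Measure.restrict_restrict measurableSet_Iio,
        hIoo, setIntegral_congr_fun (g := fun t : ℝ => t ^ (u.re - 1)) measurableSet_Ioo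
          (fun t ht => by simpa using norm_ofReal_cpow ht.1 (u - 1)),
        ← integral_Ioc_eq_integral_Ioo, ← intervalIntegral.integral_of_le hs.le,
        integral_rpow (Or.inl (by linarith))]
      simp [Real.zero_rpow hu.ne']
  refine ⟨?_, ?_⟩
  · have := hFint.integral_prod_left
    simp only [hFt] at this
    exact this
  · have hswap := integral_integral_swap (f := fun t s => F (t, s)) hFint
    simp only [hFt] at hswap
    rw [mellin, hswap, ← integral_div]
    refine integral_congr_ae ?_
    filter_upwards [hν.ae_pos] with s hs
    rw [hFs, integral_indicator measurableSet_Iio, Measure.restrict_restrict measurableSet_Iio,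
      hIoo, ← integral_Ioc_eq_integral_Ioo, ← intervalIntegral.integral_of_le hs.le,
      integral_cpow (Or.inl hre)]
    simp [zero_cpow hu0]

end IsStationary

/-! ### Mellin inversion on a shifted line -/

/-- If the Mellin transform of `h` on the line `Re u = σ` extends to a strip `σ ≤ Re u ≤ b`, with
quadratic decay, then `h` decays like `t ^ (-b)`. -/
theorem exists_norm_le_rpow_of_mellin {h : ℝ → ℂ} {D : ℂ → ℂ} {σ b : ℝ} (hσ : 0 ≤ σ)
    (hσb : σ ≤ b) (hh : MellinConvergent h σ) (hD : ∀ y : ℝ, mellin h (σ + y * I) = D (σ + y * I))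
    (hc : ContinuousOn D {u | u.re ∈ Icc σ b})
    (hd : ∀ u : ℂ, u.re ∈ Ioo σ b → DifferentiableAt ℂ D u) {K T : ℝ}
    (hK : ∀ u : ℂ, u.re ∈ Icc σ b → T ≤ |u.im| → ‖D u‖ ≤ K / u.im ^ 2) :
    ∃ A : ℝ, ∀ t : ℝ, 1 ≤ t → ContinuousAt h t → ‖h t‖ ≤ A * t ^ (-b) := by
  have hint : ∀ x ∈ Icc σ b, Integrable fun y : ℝ => D (x + y * I) := fun x hx =>
    integrable_of_norm_le_div_sq (continuous_comp_vertical hc hx) (K := K) (T := T)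
      (fun y hy => by simpa using hK (x + y * I) (by simpa using hx) (by simpa using hy))
  refine ⟨1 / (2 * Real.pi) * ∫ y : ℝ, ‖D (b + y * I)‖, fun t ht hcont => ?_⟩
  have ht0 : 0 < t := by linarith
  have htC : (t : ℂ) ≠ 0 := by exact_mod_cast ht0.ne'
  have hvert : VerticalIntegrable (mellin h) σ := by
    simpa only [VerticalIntegrable, hD] using hint σ (left_mem_Icc.2 hσb)
  have hshift : ∫ y : ℝ, (t : ℂ) ^ (-(σ + y * I)) * D (σ + y * I)
      = ∫ y : ℝ, (t : ℂ) ^ (-(b + y * I)) * D (b + y * I) := by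
    refine integral_vertical_eq (E := fun u => (t : ℂ) ^ (-u) * D u) hσb
      (K := K) (T := T) ?_ ?_ ?_
    · exact (continuous_neg.const_cpow (Or.inl htC)).continuousOn.mul hc
    · exact fun u hu => (differentiableAt_id.neg.const_cpow (Or.inl htC)).mul (hd u hu)
    · intro u hu hT
      rw [norm_mul, norm_ofReal_cpow ht0]
      refine le_trans ?_ (hK u hu hT)
      refine mul_le_of_le_one_left (norm_nonneg _) (Real.rpow_le_one_of_one_le_of_nonpos ht ?_)
      simpa using hσ.trans hu.1
  rw [← mellinInv_mellin_eq σ h ht0 hh hvert hcont, mellinInv]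
  simp only [hD, smul_eq_mul]
  rw [hshift, norm_smul, Real.norm_of_nonneg (by positivity), mul_assoc]
  refine mul_le_mul_of_nonneg_left ?_ (by positivity)
  rw [← integral_mul_const]
  refine (norm_integral_le_integral_norm _).trans_eq (integral_congr_ae (Eventually.of_forall ?_))
  intro y
  simp [norm_ofReal_cpow ht0, mul_comm]

/-! ### The comparison function -/

/-- The function `min (1, t ^ (-α))` on `(0, ∞)`. It has the tail `t ^ (-α)` and, unlike that tail
cut off at `1`, a Mellin transform that is integrable on vertical lines. -/
noncomputable def paretoTail (α : ℝ) (t : ℝ) : ℂ :=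
  (Ioc 0 1).indicator (fun _ => 1) t + (Ioi 1).indicator (fun t : ℝ => (t : ℂ) ^ (-α : ℂ)) t

theorem hasMellin_paretoTail {α : ℝ} {u : ℂ} (hu : 0 < u.re) (huα : u.re < α) :
    HasMellin (paretoTail α) u (α / (u * (α - u))) := by
  have hu0 : u ≠ 0 := fun h => by simp [h] at hu
  have huα0 : (α : ℂ) - u ≠ 0 := fun h => by
    have := congrArg re h
    simp at this
    linarith
  have h1 := hasMellin_one_Ioc hu
  have hre : (u - 1 + (-α : ℂ)).re < -1 := by
    simp
    linarith
  have hind : (fun t : ℝ => (t : ℂ) ^ (u - 1) • (Ioi 1).indicator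
      (fun t : ℝ => (t : ℂ) ^ (-α : ℂ)) t)
      = (Ioi 1).indicator fun t : ℝ => (t : ℂ) ^ (u - 1 + (-α : ℂ)) := by
    ext t
    by_cases ht : t ∈ Ioi (1 : ℝ)
    · have : (t : ℂ) ≠ 0 := by exact_mod_cast (zero_lt_one.trans ht).ne'
      simp only [indicator_of_mem ht, smul_eq_mul]
      rw [cpow_add _ _ this]
    · simp [indicator_of_notMem ht]
  have hinter : Ioi (1 : ℝ) ∩ Ioi 0 = Ioi 1 :=
    inter_eq_left.2 (Ioi_subset_Ioi zero_le_one)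
  have h2 : HasMellin (fun t => (Ioi 1).indicator (fun t : ℝ => (t : ℂ) ^ (-α : ℂ)) t) u
      (1 / (α - u)) := by
    constructor
    · rw [MellinConvergent, hind, integrableOn_indicator_iff measurableSet_Ioi, hinter]
      exact integrableOn_Ioi_cpow_of_lt hre zero_lt_one
    · rw [mellin, hind, integral_indicator measurableSet_Ioi,
        Measure.restrict_restrict measurableSet_Ioi, hinter, integral_Ioi_cpow_of_lt hre zero_lt_one]
      rw [ofReal_one, one_cpow, show u - 1 + (-α : ℂ) + 1 = -(α - u) by ring, neg_div_neg_eq]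
  have h3 := hasMellin_add h1.1 h2.1
  rw [h1.2, h2.2] at h3
  have hsum : (α : ℂ) / (u * (α - u)) = 1 / u + 1 / (α - u) := by
    field_simp
    ring
  rw [hsum]
  exact h3

theorem paretoTail_eq {α t : ℝ} (ht : 1 < t) : paretoTail α t = ((t ^ (-α) : ℝ) : ℂ) := by
  have h1 : t ∉ Ioc (0 : ℝ) 1 := fun h => ht.not_ge h.2
  rw [paretoTail, indicator_of_notMem h1, indicator_of_mem (mem_Ioi.2 ht),
    ofReal_cpow (by linarith), zero_add, ofReal_neg]

/-! ### Tail asymptotics -/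

/-- The meromorphic function `M(u) φ(u) / (u (1 - M(u)))`, with `φ` the increment moment, that
continues the Mellin transform of the tail function `G_ν` beyond the line `Re u = α`. -/
noncomputable def tailTransform (μ ν : Measure ℝ) (u : ℂ) : ℂ :=
  M μ u * incrementMoment ν u / (u * (1 - M μ u))

/-- The moment equation has no solution in the strip `0 < Re u < α`. -/
theorem IsAdmissibleLaw.M_ne_one {μ : Measure ℝ} {cm cp : ℝ} (hμ : IsAdmissibleLaw μ cm cp) {α : ℝ}
    (hMα : ∫ z, z ^ α ∂μ = 1) {u : ℂ} (hu : 0 < u.re) (huα : u.re < α) : M μ u ≠ 1 := by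
  intro h
  have h1 := hμ.norm_M_le u
  rw [h, norm_one] at h1
  linarith [hμ.integral_rpow_lt_one hMα hu huα]

namespace IsStationary

variable {μ ν : Measure ℝ} {cm cp : ℝ}

theorem hasMellin_G_tailTransform (hμ : IsAdmissibleLaw μ cm cp) (hν : IsStationary μ ν) {α : ℝ}
    (hα1 : α ≤ 1) (hMα : ∫ z, z ^ α ∂μ = 1) {u : ℂ} (hu : 0 < u.re) (huα : u.re < α) :
    HasMellin (fun t => (G ν t : ℂ)) u (tailTransform μ ν u) := by
  have hM := hμ.integral_rpow_lt_one hMα hu huα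
  have hu1 : u.re ≤ 1 := huα.le.trans hα1
  have h := hasMellin_G hν hu (integrable_rpow hμ hν hu hu1 hM)
  have hu0 : u ≠ 0 := fun h => by simp [h] at hu
  have hM1 : 1 - M μ u ≠ 0 := sub_ne_zero.2 (hμ.M_ne_one hMα hu huα).symm
  convert h using 1
  rw [tailTransform, ← integral_cpow_mul hμ hν hu hu1 hM]
  field_simp

theorem exists_norm_tailTransform_le (hμ : IsAdmissibleLaw μ cm cp) (hν : IsStationary μ ν) :
    ∃ K T : ℝ, ∀ u : ℂ, 0 ≤ u.re → u.re ≤ 1 → T ≤ |u.im| →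
      ‖tailTransform μ ν u‖ ≤ K / u.im ^ 2 := by
  obtain ⟨K₁, hK₁⟩ := hμ.exists_norm_M_mul_le
  obtain ⟨K₂, hK₂⟩ := exists_norm_incrementMoment_le hμ hν
  refine ⟨2 * K₁ * K₂, max 1 (2 * K₁), fun u hu0 hu1 hT => ?_⟩
  have hy1 : 1 ≤ |u.im| := (le_max_left _ _).trans hT
  have hy : 0 < |u.im| := by linarith
  have hnu : |u.im| ≤ ‖u‖ := abs_im_le_norm u
  have hnu1 : |u.im| ≤ ‖u + 1‖ := by simpa using abs_im_le_norm (u + 1)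
  have hM : ‖M μ u‖ ≤ K₁ / |u.im| := by
    rw [le_div_iff₀ hy]
    exact (mul_le_mul_of_nonneg_left hnu1 (norm_nonneg _)).trans (hK₁ u hu0 hu1)
  have hM2 : ‖M μ u‖ ≤ 1 / 2 := by
    refine hM.trans ?_
    rw [div_le_iff₀ hy]
    linarith [(le_max_right 1 (2 * K₁)).trans hT]
  have h1M : 1 / 2 ≤ ‖1 - M μ u‖ := by
    have := norm_sub_norm_le (1 : ℂ) (M μ u)
    rw [norm_one] at this
    linarith
  have hφ := hK₂ u hu0 hu1
  rw [tailTransform, norm_div, norm_mul, norm_mul]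
  calc ‖M μ u‖ * ‖incrementMoment ν u‖ / (‖u‖ * ‖1 - M μ u‖)
      ≤ K₁ / |u.im| * K₂ / (|u.im| * (1 / 2)) := by
        have hK20 : 0 ≤ K₂ := (norm_nonneg _).trans hφ
        have hK10 : 0 ≤ K₁ / |u.im| := (norm_nonneg _).trans hM
        gcongr
    _ = 2 * K₁ * K₂ / u.im ^ 2 := by
        rw [← sq_abs]
        field_simp

theorem continuousWithinAt_tailTransform (hμ : IsAdmissibleLaw μ cm cp) (hν : IsStationary μ ν)
    {u : ℂ} (hu : u ≠ 0) (hu1 : u.re ≤ 1) (hM : M μ u ≠ 1) :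
    ContinuousWithinAt (tailTransform μ ν) {u | u.re ≤ 1} u :=
  ((hμ.hasDerivAt_M u).continuousAt.continuousWithinAt.mul
    (continuousOn_incrementMoment hμ hν u hu1)).div
    (continuousWithinAt_id.mul
      (continuousWithinAt_const.sub (hμ.hasDerivAt_M u).continuousAt.continuousWithinAt))
    (mul_ne_zero hu (sub_ne_zero.2 hM.symm))

theorem differentiableAt_tailTransform (hμ : IsAdmissibleLaw μ cm cp) (hν : IsStationary μ ν)
    {u : ℂ} (hu : u ≠ 0) (hu1 : u.re < 1) (hM : M μ u ≠ 1) :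
    DifferentiableAt ℂ (tailTransform μ ν) u :=
  ((hμ.hasDerivAt_M u).differentiableAt.mul (differentiableAt_incrementMoment hμ hν hu1)).div
    (differentiableAt_id.mul ((differentiableAt_const _).sub (hμ.hasDerivAt_M u).differentiableAt))
    (mul_ne_zero hu (sub_ne_zero.2 hM.symm))

/-- The continued transform has a simple pole at `α`, with negative residue. -/
theorem exists_tendsto_sub_mul_tailTransform (hμ : IsAdmissibleLaw μ cm cp)
    (hν : IsStationary μ ν) {α : ℝ} (hα : 0 < α) (hα1 : α < 1) (hMα : ∫ z, z ^ α ∂μ = 1) :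
    ∃ C : ℝ, 0 < C ∧
      Tendsto (fun u : ℂ => (u - α) * tailTransform μ ν u) (𝓝[≠] (α : ℂ)) (𝓝 (-C)) := by
  obtain ⟨c, hc, hφ⟩ := exists_pos_incrementMoment_eq hμ hν hα hα1.le
  obtain ⟨d, hd, hM'⟩ := hμ.exists_pos_integral_cpow_mul_log_eq hα hMα
  have hMα1 : M μ α = 1 := by rw [hμ.M_ofReal, hMα, ofReal_one]
  have hderiv := hμ.hasDerivAt_M α
  have hslope := hasDerivAt_iff_tendsto_slope.1 hderiv
  rw [hM'] at hslope
  have hMc : Tendsto (M μ) (𝓝[≠] (α : ℂ)) (𝓝 1) := by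
    simpa [hMα1] using hderiv.continuousAt.tendsto.mono_left nhdsWithin_le_nhds
  have hφc : Tendsto (incrementMoment ν) (𝓝[≠] (α : ℂ)) (𝓝 c) := by
    rw [← hφ]
    exact (differentiableAt_incrementMoment hμ hν (by simpa using hα1)).continuousAt.tendsto.mono_left
      nhdsWithin_le_nhds
  have hid : Tendsto (fun u : ℂ => u) (𝓝[≠] (α : ℂ)) (𝓝 α) := nhdsWithin_le_nhds
  have hne : (α : ℂ) * d ≠ 0 := by exact_mod_cast (mul_pos hα hd).ne'
  refine ⟨c / (α * d), by positivity, ?_⟩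
  have hlim := ((hMc.mul hφc).div (hid.mul hslope) hne).neg
  rw [one_mul, show -((c : ℂ) / (α * d)) = -((c / (α * d) : ℝ) : ℂ) by push_cast; rfl] at hlim
  refine hlim.congr' ?_
  filter_upwards [self_mem_nhdsWithin] with u hu
  have hu' : u - α ≠ 0 := sub_ne_zero.2 hu
  have hs : 1 - M μ u = -(slope (M μ) α u * (u - α)) := by
    rw [slope_def_field, hMα1, div_mul_cancel₀ _ hu']
    ring
  rw [tailTransform, hs]
  simp only [Pi.div_apply]
  rw [mul_neg, div_neg, mul_neg, ← mul_assoc, mul_comm (u - α), div_mul_eq_mul_div,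
    mul_div_mul_right _ _ hu']

/-- The tail of the stationary law is `C t ^ (-α)` up to an error of order `t ^ (-b)`, for any
line `Re u = b ≤ 1` such that `α` is the only solution of `M(u) = 1` up to that line. -/
theorem exists_abs_G_sub_le (hμ : IsAdmissibleLaw μ cm cp) (hν : IsStationary μ ν) {α b : ℝ}
    (hα : 0 < α) (hαb : α < b) (hb : b ≤ 1) (hMα : ∫ z, z ^ α ∂μ = 1)
    (hroots : ∀ u : ℂ, u.re ∈ Icc α b → M μ u = 1 → u = (α : ℂ)) :
    ∃ C A : ℝ, 0 < C ∧ ∀ t : ℝ, 1 < t → |G ν t - C * t ^ (-α)| ≤ A * t ^ (-b) := by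
  obtain ⟨C, hC, hres⟩ := exists_tendsto_sub_mul_tailTransform hμ hν hα (hαb.trans_le hb) hMα
  obtain ⟨K, T, hKT⟩ := exists_norm_tailTransform_le hμ hν
  -- Any line `Re u = σ` with `0 < σ < α` would serve as the line of Mellin inversion.
  set σ : ℝ := α / 2 with hσdef
  have hσ : 0 < σ := by positivity
  have hσα : σ < α := by linarith
  set D : ℂ → ℂ := fun u => tailTransform μ ν u - C * (α / (u * (α - u))) with hD
  set D₀ : ℂ → ℂ := Function.update D α (limUnder (𝓝[≠] (α : ℂ)) D) with hD₀
  have hne0 : ∀ u : ℂ, u.re ∈ Icc σ b → u ≠ 0 := fun u hu h => by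
    simp [h] at hu
    linarith [hu.1]
  have hM1 : ∀ u : ℂ, u.re ∈ Icc σ b → u ≠ α → M μ u ≠ 1 := fun u hu huα h => by
    rcases lt_or_ge u.re α with hlt | hge
    · exact hμ.M_ne_one hMα (hσ.trans_le hu.1) hlt h
    · exact huα (hroots u ⟨hge, hu.2⟩ h)
  have hden : ∀ u : ℂ, u.re ∈ Icc σ b → u ≠ α → u * (α - u) ≠ 0 := fun u hu huα =>
    mul_ne_zero (hne0 u hu) (sub_ne_zero.2 huα.symm)
  have hdiff : ∀ u : ℂ, u.re ∈ Ioo σ b → u ≠ α → DifferentiableAt ℂ D u := fun u hu huα => by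
    have hu' := Ioo_subset_Icc_self hu
    have hquot : DifferentiableAt ℂ (fun v : ℂ => α / (v * (α - v))) u :=
      DifferentiableAt.div (differentiableAt_const _) (by fun_prop) (hden u hu' huα)
    exact (differentiableAt_tailTransform hμ hν (hne0 u hu') (hu.2.trans_le hb)
      (hM1 u hu' huα)).sub (hquot.const_mul _)
  have hopen : IsOpen {u : ℂ | u.re ∈ Ioo σ b} := isOpen_Ioo.preimage continuous_re
  have hαmem : (α : ℂ) ∈ {u : ℂ | u.re ∈ Ioo σ b} := ⟨by simpa using hσα, by simpa using hαb⟩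
  -- The residues of the two terms of `D` at `α` cancel, so the singularity there is removable.
  have hlittle : (fun u => D u - D α) =o[𝓝[≠] (α : ℂ)] fun u => (u - α)⁻¹ := by
    rw [isLittleO_iff_tendsto' (by
      filter_upwards [self_mem_nhdsWithin] with u hu h
      exact absurd (inv_eq_zero.1 h) (sub_ne_zero.2 hu))]
    have hid : Tendsto (fun u : ℂ => u) (𝓝[≠] (α : ℂ)) (𝓝 α) := nhdsWithin_le_nhds
    have hαC : (α : ℂ) ≠ 0 := by exact_mod_cast hα.ne'
    have h1 : Tendsto (fun u : ℂ => C * (α / u)) (𝓝[≠] (α : ℂ)) (𝓝 C) := by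
      simpa [hαC] using ((tendsto_const_nhds (x := (α : ℂ))).div hid hαC).const_mul (C : ℂ)
    have h2 : Tendsto (fun u : ℂ => (u - α) * D α) (𝓝[≠] (α : ℂ)) (𝓝 0) := by
      simpa using (hid.sub_const (α : ℂ)).mul_const (D α)
    have h3 := (hres.add h1).sub h2
    rw [neg_add_cancel, sub_zero] at h3
    refine h3.congr' ?_
    filter_upwards [self_mem_nhdsWithin, nhdsWithin_le_nhds (hopen.mem_nhds hαmem)] with u hu hu'
    have hu0 := hne0 u (Ioo_subset_Icc_self hu')
    have hs : (α : ℂ) - u ≠ 0 := sub_ne_zero.2 (Ne.symm hu)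
    have : (α : ℂ) / (u * (α - u)) * (u - α) = -(α / u) := by
      field_simp
      ring
    rw [div_inv_eq_mul]
    simp only [hD]
    linear_combination (C : ℂ) * this
  have hD₀diff : DifferentiableOn ℂ D₀ {u : ℂ | u.re ∈ Ioo σ b} :=
    differentiableOn_update_limUnder_of_isLittleO (hopen.mem_nhds hαmem)
      (fun u hu => (hdiff u hu.1 hu.2).differentiableWithinAt) hlittle
  have hD₀eq : ∀ u : ℂ, u ≠ α → D₀ u = D u := fun u hu => Function.update_of_ne hu _ _
  have hD₀cont : ContinuousOn D₀ {u : ℂ | u.re ∈ Icc σ b} := by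
    intro u hu
    rcases eq_or_ne u α with rfl | huα
    · exact (hD₀diff.differentiableAt (hopen.mem_nhds hαmem)).continuousAt.continuousWithinAt
    · have h1 : ContinuousWithinAt D {u : ℂ | u.re ∈ Icc σ b} u := by
        refine ContinuousWithinAt.sub ?_ (ContinuousAt.continuousWithinAt ?_)
        · exact (continuousWithinAt_tailTransform hμ hν (hne0 u hu) (hu.2.trans hb)
            (hM1 u hu huα)).mono fun v hv => hv.2.trans hb
        · refine continuousAt_const.mul (ContinuousAt.div continuousAt_const ?_ (hden u hu huα))
          fun_prop
      refine h1.congr_of_eventuallyEq ?_ (hD₀eq u huα)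
      filter_upwards [nhdsWithin_le_nhds (isOpen_ne.mem_nhds huα)] with v hv using hD₀eq v hv
  have hbound : ∀ u : ℂ, u.re ∈ Icc σ b → max T 1 ≤ |u.im| →
      ‖D₀ u‖ ≤ (K + C * α) / u.im ^ 2 := by
    intro u hu hT
    have hy : 0 < |u.im| := by linarith [(le_max_right T 1).trans hT]
    have huα : u ≠ α := fun h => by simp [h] at hy
    rw [hD₀eq u huα, add_div]
    refine (norm_sub_le _ _).trans (add_le_add (hKT u (hσ.le.trans hu.1) (hu.2.trans hb)
      ((le_max_left T 1).trans hT)) ?_)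
    rw [norm_mul, norm_div, norm_mul, norm_real, norm_real, Real.norm_of_nonneg hC.le,
      Real.norm_of_nonneg hα.le, mul_div_assoc, ← sq_abs, sq]
    have h1 : |u.im| ≤ ‖u‖ := abs_im_le_norm u
    have h2 : |u.im| ≤ ‖(α : ℂ) - u‖ := by simpa using abs_im_le_norm ((α : ℂ) - u)
    gcongr
  have hmellin : ∀ u : ℂ, 0 < u.re → u.re < α →
      HasMellin (fun t => (G ν t : ℂ) - C • paretoTail α t) u (D u) := fun u hu huα => by
    have h1 := hasMellin_G_tailTransform hμ hν (hαb.le.trans hb) hMα hu huα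
    have h2 := hasMellin_paretoTail hu huα
    have h3 := hasMellin_const_smul h2.1 (C : ℂ)
    have h4 := hasMellin_sub h1.1 h3.1
    rw [h1.2, h3.2, h2.2] at h4
    simpa using h4
  obtain ⟨A, hA⟩ := exists_norm_le_rpow_of_mellin (h := fun t => (G ν t : ℂ) - C • paretoTail α t)
    hσ.le (hσα.le.trans hαb.le) (hmellin σ (by simpa using hσ) (by simpa using hσα)).1
    (fun y => by
      rw [(hmellin (σ + y * I) (by simpa using hσ) (by simpa using hσα)).2, hD₀eq]
      intro h
      have := congrArg re h
      simp at this
      linarith)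
    hD₀cont (fun u hu => hD₀diff.differentiableAt (hopen.mem_nhds hu)) hbound
  refine ⟨C, A, hC, fun t ht => ?_⟩
  have hloc : (fun t => (G ν t : ℂ) - C • paretoTail α t) =ᶠ[𝓝 t]
      fun t => ((G ν t - C * t ^ (-α) : ℝ) : ℂ) := by
    filter_upwards [lt_mem_nhds ht] with s hs
    rw [paretoTail_eq hs]
    simp
  have hcont : ContinuousAt (fun t => ((G ν t - C * t ^ (-α) : ℝ) : ℂ)) t :=
    continuous_ofReal.continuousAt.comp ((continuous_G hμ hν).continuousAt.sub
      (continuousAt_const.mul (Real.continuousAt_rpow_const _ _ (Or.inl (by linarith)))))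
  have := hA t ht.le (hcont.congr hloc.symm)
  rwa [hloc.eq_of_nhds, norm_real, Real.norm_eq_abs] at this

end IsStationary

end DerridaHilhorst

theorem lemma4p6
    (μ : Measure ℝ) (cm cp : ℝ) (hμ : DerridaHilhorst.IsAdmissibleLaw μ cm cp)
    (α : ℝ) (hα : 0 < α) (hMα : ∫ z, z ^ α ∂μ = 1)
    (δ : ℝ) (hδ : 0 < δ) (hδα : δ ≤ α) (hδα' : δ ≤ 1 - α)
    (hroots : ∀ u : ℂ, u.re ∈ Icc α (α + δ) → DerridaHilhorst.M μ u = 1 → u = (α : ℂ))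
    (ν₀ : Measure ℝ) (hν₀ : DerridaHilhorst.IsStationary μ ν₀) :
    ∃ (C : ℝ) (R : ℝ → ℝ), C ≠ 0 ∧
      (∀ t : ℝ, 0 < t → DerridaHilhorst.G ν₀ t = C * (t ^ (-α) + R t)) ∧
      R =O[atTop] (fun t : ℝ => t ^ (-α - δ)) := by
  obtain ⟨C, A, hC, hA⟩ := DerridaHilhorst.IsStationary.exists_abs_G_sub_le hμ hν₀ hα
    (lt_add_of_pos_right α hδ) (by linarith) hMα hroots
  refine ⟨C, fun t => DerridaHilhorst.G ν₀ t / C - t ^ (-α), hC.ne', fun t _ => ?_, ?_⟩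
  · field_simp
    ring
  · refine IsBigO.of_bound (A / C) ?_
    filter_upwards [eventually_gt_atTop 1] with t ht
    have h := hA t ht
    rw [Real.norm_of_nonneg (Real.rpow_nonneg (by linarith) (-α - δ)), Real.norm_eq_abs,
      show DerridaHilhorst.G ν₀ t / C - t ^ (-α)
        = (DerridaHilhorst.G ν₀ t - C * t ^ (-α)) / C by field_simp,
      abs_div, abs_of_pos hC, div_mul_eq_mul_div, div_le_div_iff_of_pos_right hC, ← neg_add']
    exact h
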